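/- Let $p$ be a prime and let $X$ be a path-connected topological space with base point $x$ and an isomorphism $e\colon \pi_1(X,x)\cong C_p=\mathbb{Z}/p$. Let $H^*(X;\mathbb{F}_p)$ be singular cohomology, $C^*(X;\mathbb{F}_p)$ the singular cochain algebra with coboundary $d$ and cup product $\smile$. For $n\ge 2$ and a class $T\in H^1(X;\mathbb{F}_p)$, the $n$-fold Massey power $\langle T,\ldots,T\rangle\subseteq H^2(X;\mathbb{F}_p)$ is the set of all classes $\big[\sum_{0<k<n} a_{0k}\smile a_{kn}\big]$, where $(a_{ij})_{0\le i<j\le n,\ (i,j)\ne(0,n)}$ runs over the families of $1$-cochains such that each $a_{i-1,i}$ is a cocycle representing $T$ and $d a_{ij}=\sum_{i<k<j}a_{ik}\smile a_{kj}$ for all $(i,j)\neq(0,n)$ with $i<j$. Then $H^1(X;\mathbb{F}_p)=\mathbb{F}_p\cdot T$ is generated by the class $T$ whose evaluation on a loop $\gamma$ at $x$ is $e([\gamma])\in\mathbb{Z}/p$. Moreover, for every generator $T$ of $H^1(X;\mathbb{F}_p)$: 1. for every $k$ with $2\le k\le p-1$, the cup power $T^{k}\in H^k(X;\mathbb{F}_p)$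 is zero and the $k$-fold Massey power $\langle T,\ldots,T\rangle$ is defined and vanishes, with no indeterminacy: it is $\{0\}$; 2. the $p$-fold Massey power $\langle \underbrace{T,\ldots,T}_{p}\rangle$ is defined, has no indeterminacy, and is nonzero: it is $\{\mu\}$ for some $\mu\neq0$ in $H^2(X;\mathbb{F}_p)$. (For $p=2$ this is the cup square $T\smile T$.) -/

import Mathlib

noncomputable section

namespace MasseyPower

open CategoryTheory Opposite

universe u v

/-! ### Simplicial cochains, cohomology and cup products -/

section Cochains

variable (X : SSet.{u}) (A : Type v) [CommRing A]

/-- `A`-valued simplicial `n`-cochains of `X`: all functions on the set of `n`-simplices. -/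
abbrev Cochain (n : ℕ) : Type (max u v) := X.obj (op (SimplexCategory.mk n)) → A

/-- The simplicial coboundary `(d f)(σ) = ∑ i, (-1)^i f(δᵢ σ)`. -/
def d (n : ℕ) : Cochain X A n →ₗ[A] Cochain X A (n + 1) where
  toFun f σ := ∑ i : Fin (n + 2), (-1) ^ (i : ℕ) * f (X.δ i σ)
  map_add' f g := by
    funext σ
    simp [mul_add, Finset.sum_add_distrib]
  map_smul' c f := by
    funext σ
    simp only [Pi.smul_apply, smul_eq_mul, RingHom.id_apply, Finset.mul_sum]
    exact Finset.sum_congr rfl fun i _ => by ring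

/-- The submodule of `n`-cocycles. -/
def cocycles (n : ℕ) : Submodule A (Cochain X A n) := LinearMap.ker (d X A n)

/-- The submodule of `n`-coboundaries. -/
def coboundaries : (n : ℕ) → Submodule A (Cochain X A n)
  | 0 => ⊥
  | n + 1 => LinearMap.range (d X A n)

/-- The `n`-th cohomology of `X` with coefficients in `A`: cocycles modulo coboundaries. -/
abbrev H (n : ℕ) : Type (max u v) :=
  cocycles X A n ⧸ (coboundaries X A n).submoduleOf (cocycles X A n)

variable {X A}

/-- The cohomology class of a cocycle. -/
def cls {n : ℕ} (a : cocycles X A n) : H X A n := Submodule.Quotient.mk a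

/-- The (Alexander–Whitney) cup product of cochains:
`(a ⌣ b)(σ) = a(front m-face of σ) * b(back n-face of σ)`. -/
def cup {m n : ℕ} (a : Cochain X A m) (b : Cochain X A n) : Cochain X A (m + n) := fun σ =>
  a (X.map (SimplexCategory.subinterval 0 m (by omega)).op σ) *
    b (X.map (SimplexCategory.subinterval m n le_rfl).op σ)

/-- The iterated cup power `a ⌣ ⋯ ⌣ a` (`k` factors) of a `1`-cochain, as a `k`-cochain;
the empty product is the constant `0`-cochain `1`. -/
def cupPow (a : Cochain X A 1) : (k : ℕ) → Cochain X A k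
  | 0 => fun _ => 1
  | 1 => a
  | k + 2 => cup (m := k + 1) (n := 1) (cupPow a (k + 1)) a

lemma cup_one_one_apply (a b : Cochain X A 1) (σ : X.obj (op (SimplexCategory.mk 2))) :
    cup a b σ = a (X.δ 2 σ) * b (X.δ 0 σ) := by
  have h2 : SimplexCategory.subinterval (n := 2) 0 1 (by omega) = SimplexCategory.δ 2 := by
    ext i; fin_cases i <;> rfl
  have h0 : SimplexCategory.subinterval (n := 2) 1 1 le_rfl = SimplexCategory.δ 0 := by
    ext i; fin_cases i <;> rfl
  change a (X.map (SimplexCategory.subinterval (n := 2) 0 1 (by omega)).op σ) *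
    b (X.map (SimplexCategory.subinterval (n := 2) 1 1 le_rfl).op σ) = _
  rw [h2, h0]
  rfl

lemma d_one_apply (a : Cochain X A 1) (σ : X.obj (op (SimplexCategory.mk 2))) :
    d X A 1 a σ = a (X.δ 0 σ) - a (X.δ 1 σ) + a (X.δ 2 σ) := by
  simp [d, Fin.sum_univ_succ]
  ring

lemma d_two_apply (a : Cochain X A 2) (σ : X.obj (op (SimplexCategory.mk 3))) :
    d X A 2 a σ = a (X.δ 0 σ) - a (X.δ 1 σ) + a (X.δ 2 σ) - a (X.δ 3 σ) := by
  simp [d, Fin.sum_univ_succ]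
  ring

lemma face_face {i j : Fin 3} (h : i ≤ j) {i' j' : Fin 4} (hi : i' = i.castSucc)
    (hj : j' = j.succ) (σ : X.obj (op (SimplexCategory.mk 3))) :
    X.δ j (X.δ i' σ) = X.δ i (X.δ j' σ) := by
  subst hi hj
  exact (SSet.δ_comp_δ_apply (S := X) (n := 1) h σ).symm

end Cochains

/-! ### Massey products of classes of degree one -/

section Massey

variable {X : SSet.{u}} {A : Type v} [CommRing A]

/-- A defining system for the `n`-fold Massey product `⟨u₁, …, uₙ⟩` (`n ≥ 2`) of classes of
degree one: `1`-cochains `a i j` for `0 ≤ i < j ≤ n`, `(i, j) ≠ (0, n)`, such that `a (i-1) i` is a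
cocycle representing `uᵢ` and `d (a i j) = ∑_{i < k < j} a i k ⌣ a k j`.
(The entries of `a` at other indices play no role.) -/
structure DefiningSystem (n : ℕ) (u : Fin n → H X A 1) where
  /-- The cochains of the system. -/
  a : Fin (n + 1) → Fin (n + 1) → Cochain X A 1
  rep : ∀ i : Fin n, ∃ z : cocycles X A 1, z.1 = a i.castSucc i.succ ∧ cls z = u i
  d_eq : ∀ i j : Fin (n + 1), i < j → ¬ (i = 0 ∧ j = Fin.last n) →
    d X A 1 (a i j) = ∑ k ∈ Finset.Ioo i j, cup (a i k) (a k j)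

namespace DefiningSystem

variable {n : ℕ} {u : Fin n → H X A 1} (D : DefiningSystem n u)

/-- The `2`-cochain `∑_{0 < k < n} a 0 k ⌣ a k n` attached to a defining system. -/
def valueCochain : Cochain X A 2 :=
  ∑ k ∈ Finset.Ioo 0 (Fin.last n), cup (D.a 0 k) (D.a k (Fin.last n))

/-- The value cochain of a defining system is a cocycle. -/
lemma valueCochain_mem : D.valueCochain ∈ cocycles X A 2 := by
  rw [cocycles, LinearMap.mem_ker]
  funext σ
  -- the edges of the `3`-simplex `σ` that occur twice
  have h12 : X.δ 0 (X.δ 3 σ) = X.δ 2 (X.δ 0 σ) :=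
    (face_face (i := 0) (j := 2) (by decide) rfl rfl σ).symm
  have h23 : X.δ 0 (X.δ 1 σ) = X.δ 0 (X.δ 0 σ) :=
    (face_face (i := 0) (j := 0) (by decide) rfl rfl σ).symm
  have h13 : X.δ 0 (X.δ 2 σ) = X.δ 1 (X.δ 0 σ) :=
    (face_face (i := 0) (j := 1) (by decide) rfl rfl σ).symm
  have h02 : X.δ 1 (X.δ 3 σ) = X.δ 2 (X.δ 1 σ) :=
    (face_face (i := 1) (j := 2) (by decide) rfl rfl σ).symm
  have h01 : X.δ 2 (X.δ 3 σ) = X.δ 2 (X.δ 2 σ) :=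
    (face_face (i := 2) (j := 2) (by decide) rfl rfl σ).symm
  have hl : ∀ k ∈ Finset.Ioo 0 (Fin.last n),
      D.a 0 k (X.δ 2 (X.δ 0 σ)) - D.a 0 k (X.δ 2 (X.δ 1 σ)) + D.a 0 k (X.δ 2 (X.δ 2 σ)) =
        ∑ l ∈ Finset.Ioo 0 k, D.a 0 l (X.δ 2 (X.δ 2 σ)) * D.a l k (X.δ 2 (X.δ 0 σ)) := by
    intro k hk
    rw [Finset.mem_Ioo] at hk
    have h := congrFun (D.d_eq 0 k hk.1 fun h => hk.2.ne h.2) (X.δ 3 σ)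
    rw [d_one_apply, Finset.sum_apply, h12, h02, h01] at h
    rw [h]
    exact Finset.sum_congr rfl fun l _ => by rw [cup_one_one_apply, h12, h01]
  have hr : ∀ k ∈ Finset.Ioo 0 (Fin.last n),
      D.a k (Fin.last n) (X.δ 0 (X.δ 0 σ)) - D.a k (Fin.last n) (X.δ 1 (X.δ 0 σ)) +
          D.a k (Fin.last n) (X.δ 2 (X.δ 0 σ)) =
        ∑ l ∈ Finset.Ioo k (Fin.last n),
          D.a k l (X.δ 2 (X.δ 0 σ)) * D.a l (Fin.last n) (X.δ 0 (X.δ 0 σ)) := by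
    intro k hk
    rw [Finset.mem_Ioo] at hk
    have h := congrFun (D.d_eq k _ hk.2 fun h => hk.1.ne' h.1) (X.δ 0 σ)
    rw [d_one_apply, Finset.sum_apply] at h
    rw [h]
    exact Finset.sum_congr rfl fun l _ => by rw [cup_one_one_apply]
  have hswap : ∑ k ∈ Finset.Ioo 0 (Fin.last n), ∑ l ∈ Finset.Ioo 0 k,
        D.a 0 l (X.δ 2 (X.δ 2 σ)) * D.a l k (X.δ 2 (X.δ 0 σ)) *
          D.a k (Fin.last n) (X.δ 0 (X.δ 0 σ)) =
      ∑ k ∈ Finset.Ioo 0 (Fin.last n), ∑ l ∈ Finset.Ioo k (Fin.last n),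
        D.a 0 k (X.δ 2 (X.δ 2 σ)) * (D.a k l (X.δ 2 (X.δ 0 σ)) *
          D.a l (Fin.last n) (X.δ 0 (X.δ 0 σ))) := by
    rw [Finset.sum_comm' (t' := Finset.Ioo 0 (Fin.last n))
      (s' := fun l => Finset.Ioo l (Fin.last n))]
    · simp only [mul_assoc]
    · intro k l
      simp only [Finset.mem_Ioo]
      constructor
      · rintro ⟨⟨h1, h2⟩, h3, h4⟩
        exact ⟨⟨h4, h2⟩, h3, h4.trans h2⟩
      · rintro ⟨⟨h1, h2⟩, h3, h4⟩
        exact ⟨⟨h3.trans h1, h2⟩, h3, h1⟩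
  rw [d_two_apply, valueCochain]
  simp only [Finset.sum_apply, cup_one_one_apply, h12, h23, h13, h01]
  rw [← Finset.sum_sub_distrib, ← Finset.sum_add_distrib, ← Finset.sum_sub_distrib,
    Pi.zero_apply, ← sub_eq_zero.mpr hswap, ← Finset.sum_sub_distrib]
  refine Finset.sum_congr rfl fun k hk => ?_
  rw [← Finset.sum_mul, ← Finset.mul_sum, ← hl k hk, ← hr k hk]
  ring

/-- The class in degree two attached to a defining system. -/
def value : H X A 2 := cls ⟨D.valueCochain, D.valueCochain_mem⟩

end DefiningSystem

/-- The `n`-fold Massey product `⟨u₁, …, uₙ⟩` (`n ≥ 2`) of classes of degree one: the set of values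
of all its defining systems. It is defined if this set is nonempty. -/
def masseyProduct {n : ℕ} (u : Fin n → H X A 1) : Set (H X A 2) :=
  Set.range (DefiningSystem.value (u := u))

/-- The `n`-fold Massey power `⟨T, …, T⟩` (`n ≥ 2`). -/
def masseyPower (T : H X A 1) (n : ℕ) : Set (H X A 2) :=
  masseyProduct fun _ : Fin n => T

end Massey

/-! ### Singular cochains of a topological space -/

section Singular

/-- The singular simplicial set of a topological space. -/
abbrev Sing (X : Type u) [TopologicalSpace X] : SSet.{u} := TopCat.toSSet.obj (TopCat.of X)

/-- A path, regarded as a singular `1`-simplex. -/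
def pathSimplex {X : Type u} [TopologicalSpace X] {x y : X} (γ : Path x y) :
    (Sing X).obj (op (SimplexCategory.mk 1)) :=
  TopCat.toSSetObj₁Equiv.symm
    (TopCat.ofHom (γ.toContinuousMap.comp (toContinuousMap TopCat.I.homeomorph)))

end Singular

end MasseyPower

end

/-! Assemble the cochains of a defining system, evaluated on a singular edge τ, into the
unitriangular matrix `1 - a(τ)` of size n + 1. The equations `d a = ∑ a ⌣ a` say that, off the upper
right corner, these matrices multiply along singular triangles. A function that multiplies along
triangles and is 1 on constant paths is a homotopy invariant of paths (`IsMulCocycle.homotopic`). A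
defining system thus represents π₁ = C_p by unitriangular matrices modulo the corner, and its value
is the obstruction to lifting this over the corner.

Let g be a loop of class 1, G its matrix, t = T(g), and E the corner matrix unit. By Frobenius, G ^
p = 1 - N ^ p with N = 1 - G strictly upper triangular and superdiagonal t. For n < p this is 1; for
n = p it is 1 - t ^ p E (`unitri_pow_char`).

If n = p and the value bounded, a primitive placed in the corner would give a true representation,
forcing G ^ p = 1 although t ≠ 0 (`value_ne_zero`). In general, writing each edge as a return path,
a power of G and an outgoing path gives matrices with the same blocks; they fail to multiply only by
the carry of addition mod p times the corner of G ^ p. Hence the value is a coboundary plus a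
multiple of the carry cochain, the multiple being fixed by T (`valueCochain_eq`): there is no
indeterminacy, and the value vanishes for n < p.

Defining systems exist by taking coefficients of (1 - X) ^ z(τ) modulo X ^ p. For odd p, `-z ^ 2 /
2` bounds `z ⌣ z`, which kills the higher cup powers as well. -/

noncomputable section

namespace MasseyPower

open CategoryTheory Opposite

universe u v

/-! ### Singular edges and triangles as paths and homotopies -/

section Triangles

variable {X : Type u} [TopologicalSpace X]

/-- The point of the `1`-simplex with barycentric coordinates `(1 - s, s)`. -/
def edgePoint (s : unitInterval) : stdSimplex ℝ (Fin 2) := stdSimplexHomeomorphUnitInterval.symm s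

lemma edgePoint_zero (s : unitInterval) : edgePoint s 0 = 1 - s := rfl

lemma edgePoint_one (s : unitInterval) : edgePoint s 1 = s := rfl

lemma edgePoint_bot : edgePoint 0 = stdSimplex.vertex 0 :=
  (stdSimplexHomeomorphUnitInterval.symm_apply_eq).2 stdSimplexHomeomorphUnitInterval_zero.symm

lemma edgePoint_top : edgePoint 1 = stdSimplex.vertex 1 :=
  (stdSimplexHomeomorphUnitInterval.symm_apply_eq).2 stdSimplexHomeomorphUnitInterval_one.symm

lemma continuous_edgePoint : Continuous edgePoint :=
  stdSimplexHomeomorphUnitInterval.symm.continuous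

lemma pathSimplex_eq_iff {y z : X} (γ : Path y z)
    (τ : (Sing X).obj (op (SimplexCategory.mk 1))) :
    τ = pathSimplex γ ↔
      ∀ s, TopCat.toSSetObjEquiv (TopCat.of X) _ τ (edgePoint s) = γ s := by
  refine Iff.trans (Equiv.eq_symm_apply _) ?_
  constructor
  · intro h s
    have := congrArg (fun f : TopCat.I ⟶ TopCat.of X => f.hom (ULift.up s)) h
    exact this
  · intro h
    ext s
    exact h s.down

/-- The singular simplex given by a continuous map. -/
def simplexOf {n : ℕ} (q : C(stdSimplex ℝ (Fin (n + 1)), X)) :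
    (Sing X).obj (op (SimplexCategory.mk n)) :=
  (TopCat.toSSetObjEquiv (TopCat.of X) (op (SimplexCategory.mk n))).symm q

lemma δ_simplexOf_eq_pathSimplex {y z : X} (γ : Path y z) (q : C(stdSimplex ℝ (Fin 3), X))
    (i : Fin 3) (h : ∀ s, q (stdSimplex.map i.succAbove (edgePoint s)) = γ s) :
    (Sing X).δ i (simplexOf q) = pathSimplex γ :=
  (pathSimplex_eq_iff _ _).2 h

lemma map_edgePoint (i : Fin 3) (s : unitInterval) :
    (stdSimplex.map i.succAbove (edgePoint s) : Fin 3 → ℝ) =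
      ![![0, 1 - (s : ℝ), s], ![1 - (s : ℝ), 0, s], ![1 - (s : ℝ), s, 0]] i := by
  funext j
  rw [stdSimplex.map_coe, FunOnFinite.linearMap_apply_apply, Finset.sum_filter, Fin.sum_univ_two,
    edgePoint_zero, edgePoint_one]
  fin_cases i <;> fin_cases j <;> simp [Fin.succAbove]

/-- The faces of a singular triangle are paths, and the composite of the first and the last edge
is homotopic to the middle one. -/
lemma exists_triangle (σ : (Sing X).obj (op (SimplexCategory.mk 2))) :
    ∃ (a b c : X) (γ : Path a b) (γ' : Path b c) (γ'' : Path a c),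
      (Sing X).δ 2 σ = pathSimplex γ ∧ (Sing X).δ 0 σ = pathSimplex γ' ∧
      (Sing X).δ 1 σ = pathSimplex γ'' ∧ (γ.trans γ').Homotopic γ'' := by
  obtain ⟨q, rfl⟩ := (TopCat.toSSetObjEquiv (TopCat.of X)
    (op (SimplexCategory.mk 2))).symm.surjective σ
  change C(stdSimplex ℝ (Fin 3), X) at q
  -- The relation between the edges already holds in the contractible standard triangle; it is
  -- pushed forward along q.
  have : ContractibleSpace (stdSimplex ℝ (Fin 3)) :=
    (convex_stdSimplex ℝ (Fin 3)).contractibleSpace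
      ⟨_, (stdSimplex.vertex (S := ℝ) (0 : Fin 3)).2⟩
  let edge (i : Fin 3) (j k : Fin 3) (hj : i.succAbove 0 = j) (hk : i.succAbove 1 = k) :
      Path (stdSimplex.vertex (S := ℝ) j) (stdSimplex.vertex (S := ℝ) k) :=
    { toFun := fun s => stdSimplex.map i.succAbove (edgePoint s)
      continuous_toFun := (stdSimplex.continuous_map _).comp continuous_edgePoint
      source' := by rw [edgePoint_bot, stdSimplex.map_vertex, hj]
      target' := by rw [edgePoint_top, stdSimplex.map_vertex, hk] }
  let g₂ := edge 2 0 1 rfl rfl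
  let g₀ := edge 0 1 2 rfl rfl
  let g₁ := edge 1 0 2 rfl rfl
  refine ⟨_, _, _, g₂.map q.continuous, g₀.map q.continuous, g₁.map q.continuous,
    δ_simplexOf_eq_pathSimplex _ q 2 fun s => rfl, δ_simplexOf_eq_pathSimplex _ q 0 fun s => rfl,
    δ_simplexOf_eq_pathSimplex _ q 1 fun s => rfl, ?_⟩
  rw [← Path.map_trans]
  exact (SimplyConnectedSpace.paths_homotopic (g₂.trans g₀) g₁).map q

lemma exists_path (τ : (Sing X).obj (op (SimplexCategory.mk 1))) :
    ∃ (a b : X) (γ : Path a b), τ = pathSimplex γ :=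
  ⟨_, _, ⟨(TopCat.toSSetObjEquiv (TopCat.of X) _ τ).comp ⟨edgePoint, continuous_edgePoint⟩,
    rfl, rfl⟩, (pathSimplex_eq_iff _ _).2 fun _ => rfl⟩

lemma pathSimplex_heq {a b a' b' : X} {γ : Path a b} {γ' : Path a' b'}
    (h : pathSimplex γ = pathSimplex γ') : a = a' ∧ b = b' ∧ HEq γ γ' := by
  have h' : ∀ s, γ s = γ' s := fun s => by
    rw [← (pathSimplex_eq_iff γ' _).1 h s, ← (pathSimplex_eq_iff γ _).1 rfl s]
  have h0 := h' 0
  have h1 := h' 1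
  rw [γ.source, γ'.source] at h0
  rw [γ.target, γ'.target] at h1
  subst h0 h1
  exact ⟨rfl, rfl, heq_of_eq (Path.ext (funext h'))⟩

/-- A `0`-simplex of the singular set, from a point. -/
abbrev pointSimplex (y : X) : (Sing X).obj (op (SimplexCategory.mk 0)) :=
  (TopCat.toSSetObj₀Equiv (X := TopCat.of X)).symm y

lemma δ_zero_pathSimplex {y z : X} (γ : Path y z) :
    (Sing X).δ 0 (pathSimplex γ) = pointSimplex z := by
  refine (TopCat.δ_zero_toSSetObj₁Equiv.symm _).trans ?_
  exact congrArg _ γ.target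

lemma δ_one_pathSimplex {y z : X} (γ : Path y z) :
    (Sing X).δ 1 (pathSimplex γ) = pointSimplex y := by
  refine (TopCat.δ_one_toSSetObj₁Equiv.symm _).trans ?_
  exact congrArg _ γ.source

end Triangles

/-! ### Multiplicative cocycles are homotopy invariants -/

section Multiplicative

variable {X : Type u} [TopologicalSpace X] {G : Type v} [Monoid G]

/-- A function on singular `1`-simplices with values in a monoid is a multiplicative cocycle if it
is multiplicative along singular triangles and trivial on constant paths. -/
structure IsMulCocycle (f : (Sing X).obj (op (SimplexCategory.mk 1)) → G) : Prop where
  triangle : ∀ σ, f ((Sing X).δ 1 σ) = f ((Sing X).δ 2 σ) * f ((Sing X).δ 0 σ)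
  refl : ∀ y : X, f (pathSimplex (Path.refl y)) = 1

namespace IsMulCocycle

variable {f : (Sing X).obj (op (SimplexCategory.mk 1)) → G} 

/-- Evaluate on the triangle that factors through the concatenated path, with vertices at times 0,
1/2 and 1. -/
lemma trans (hf : IsMulCocycle f) {a b c : X} (γ : Path a b) (γ' : Path b c) :
    f (pathSimplex (γ.trans γ')) = f (pathSimplex γ) * f (pathSimplex γ') := by
  let q : C(stdSimplex ℝ (Fin 3), X) :=
    ⟨fun t => (γ.trans γ').extend (t 1 / 2 + t 2), by
      refine (γ.trans γ').continuous_extend.comp ?_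
      have h : ∀ i, Continuous fun t : stdSimplex ℝ (Fin 3) => t i := fun i =>
        (continuous_apply i).comp continuous_subtype_val
      exact ((h 1).div_const 2).add (h 2)⟩
  have hq (i : Fin 3) (s : unitInterval) : q (stdSimplex.map i.succAbove (edgePoint s)) =
      (γ.trans γ').extend
        (![![0, 1 - (s : ℝ), s], ![1 - (s : ℝ), 0, s], ![1 - (s : ℝ), s, 0]] i 1 / 2
        + ![![0, 1 - (s : ℝ), s], ![1 - (s : ℝ), 0, s], ![1 - (s : ℝ), s, 0]] i 2) := by
    rw [← map_edgePoint]
    rfl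
  have h := hf.triangle (simplexOf q)
  rw [δ_simplexOf_eq_pathSimplex (γ.trans γ') q 1, δ_simplexOf_eq_pathSimplex γ q 2,
    δ_simplexOf_eq_pathSimplex γ' q 0] at h
  · exact h
  · intro s
    have h0 := s.2.1
    rw [hq, Path.extend_trans_of_half_le _ _ (by simp; linarith)]
    convert Path.extend_apply γ' s.2 using 2
    simp
    ring
  · intro s
    have h1 := s.2.2
    rw [hq, Path.extend_trans_of_le_half _ _ (by simp; linarith)]
    convert Path.extend_apply γ s.2 using 2
    simp
    ring
  · intro s
    rw [hq]
    convert Path.extend_apply (γ.trans γ') s.2 using 2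
    simp

/-- Cut the square of the homotopy along its diagonal. Each half has one constant edge, so both
paths have the value of the diagonal. -/
lemma homotopic (hf : IsMulCocycle f) {a b : X} {γ γ' : Path a b} (h : γ.Homotopic γ') :
    f (pathSimplex γ) = f (pathSimplex γ') := by
  obtain ⟨F⟩ := h
  let q : C(stdSimplex ℝ (Fin 3), X) :=
    ⟨fun t => F (⟨t 2, stdSimplex.zero_le t 2, stdSimplex.le_one t 2⟩,
        ⟨1 - t 0, sub_nonneg.2 (stdSimplex.le_one t 0), sub_le_self 1 (stdSimplex.zero_le t 0)⟩), by
      have h : ∀ i, Continuous fun t : stdSimplex ℝ (Fin 3) => t i := fun i =>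
        (continuous_apply i).comp continuous_subtype_val
      exact F.continuous.comp (((h 2).subtype_mk _).prodMk
        ((continuous_const.sub (h 0)).subtype_mk _))⟩
  let q' : C(stdSimplex ℝ (Fin 3), X) :=
    ⟨fun t => F (⟨1 - t 0, sub_nonneg.2 (stdSimplex.le_one t 0),
        sub_le_self 1 (stdSimplex.zero_le t 0)⟩,
        ⟨t 2, stdSimplex.zero_le t 2, stdSimplex.le_one t 2⟩), by
      have h : ∀ i, Continuous fun t : stdSimplex ℝ (Fin 3) => t i := fun i =>
        (continuous_apply i).comp continuous_subtype_val
      exact F.continuous.comp (((continuous_const.sub (h 0)).subtype_mk _).prodMk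
        ((h 2).subtype_mk _))⟩
  let diag : Path a b :=
    { toFun := fun s => F (s, s)
      source' := by simp
      target' := by simp }
  have hc (i j : Fin 3) (s : unitInterval) : stdSimplex.map i.succAbove (edgePoint s) j =
      ![![0, 1 - (s : ℝ), s], ![1 - (s : ℝ), 0, s], ![1 - (s : ℝ), s, 0]] i j :=
    congrFun (map_edgePoint i s) j
  have h := hf.triangle (simplexOf q)
  have h' := hf.triangle (simplexOf q')
  rw [δ_simplexOf_eq_pathSimplex diag q 1, δ_simplexOf_eq_pathSimplex γ q 2,
    δ_simplexOf_eq_pathSimplex (Path.refl b) q 0, hf.refl, mul_one] at h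
  · rw [δ_simplexOf_eq_pathSimplex diag q' 1, δ_simplexOf_eq_pathSimplex (Path.refl a) q' 2,
      δ_simplexOf_eq_pathSimplex γ' q' 0, hf.refl, one_mul] at h'
    · rw [← h, h']
    · intro s
      refine Eq.trans ?_ (F.apply_one s)
      change F _ = F _
      congr 2 <;> ext <;> simp only [hc] <;> simp
    · intro s
      refine Eq.trans ?_ (F.source s)
      change F _ = F _
      congr 2 <;> ext <;> simp only [hc] <;> simp
    · intro s
      change F _ = F _
      congr 2 <;> ext <;> simp only [hc] <;> simp
  · intro s
    refine Eq.trans ?_ (F.target s)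
    change F _ = F _
    congr 2 <;> ext <;> simp only [hc] <;> simp
  · intro s
    refine Eq.trans ?_ (F.apply_zero s)
    change F _ = F _
    congr 2 <;> ext <;> simp only [hc] <;> simp
  · intro s
    change F _ = F _
    congr 2 <;> ext <;> simp only [hc] <;> simp

lemma mul_symm (hf : IsMulCocycle f) {a b : X} (γ : Path a b) :
    f (pathSimplex γ) * f (pathSimplex γ.symm) = 1 := by
  rw [← hf.trans, ← hf.refl a]
  exact hf.homotopic ⟨(Path.Homotopy.reflTransSymm γ).symm⟩

lemma symm_mul (hf : IsMulCocycle f) {a b : X} (γ : Path a b) :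
    f (pathSimplex γ.symm) * f (pathSimplex γ) = 1 := by
  simpa using hf.mul_symm γ.symm

end IsMulCocycle

end Multiplicative

/-! ### Loops, their classes, and the fundamental cochain -/

section Loops

variable {X : Type u} [TopologicalSpace X] {p : ℕ} {x : X}

/-- The `n`-fold concatenation of a loop. -/
def loopPow (γ : Path x x) : ℕ → Path x x
  | 0 => Path.refl x
  | n + 1 => (loopPow γ n).trans γ

lemma IsMulCocycle.loopPow {G : Type v} [Monoid G]
    {f : (Sing X).obj (op (SimplexCategory.mk 1)) → G} (hf : IsMulCocycle f) (γ : Path x x)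
    (n : ℕ) : f (pathSimplex (loopPow γ n)) = f (pathSimplex γ) ^ n := by
  induction n with
  | zero => rw [MasseyPower.loopPow, hf.refl, pow_zero]
  | succ n ih => rw [MasseyPower.loopPow, hf.trans, ih, pow_succ]

variable (e : FundamentalGroup X x ≃* Multiplicative (ZMod p))

/-- The value of an isomorphism `π₁(X, x) ≃ ℤ/p` on a loop. -/
def loopClass (γ : Path x x) : ZMod p :=
  (e (FundamentalGroup.fromPath (Path.Homotopic.Quotient.mk γ))).toAdd

lemma loopClass_eq_iff {γ γ' : Path x x} : loopClass e γ = loopClass e γ' ↔ γ.Homotopic γ' := by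
  rw [← Path.Homotopic.Quotient.eq]
  exact e.injective.eq_iff

lemma loopClass_trans (γ γ' : Path x x) :
    loopClass e (γ.trans γ') = loopClass e γ + loopClass e γ' := by
  -- The product in `FundamentalGroup` composes in the order opposite to concatenation; this is
  -- harmless in a commutative target.
  rw [add_comm]
  exact congrArg Multiplicative.toAdd (e.map_mul
    (FundamentalGroup.fromPath (Path.Homotopic.Quotient.mk γ'))
    (FundamentalGroup.fromPath (Path.Homotopic.Quotient.mk γ)))

lemma loopClass_refl : loopClass e (Path.refl x) = 0 :=
  congrArg Multiplicative.toAdd e.map_one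

lemma exists_loopClass_eq (s : ZMod p) : ∃ γ : Path x x, loopClass e γ = s := by
  obtain ⟨g, hg⟩ := e.surjective (Multiplicative.ofAdd s)
  obtain ⟨γ, hγ⟩ := Path.Homotopic.Quotient.mk_surjective (FundamentalGroup.toPath g)
  refine ⟨γ, ?_⟩
  rw [loopClass, hγ]
  exact congrArg Multiplicative.toAdd hg

lemma loopClass_loopPow (γ : Path x x) (n : ℕ) : loopClass e (loopPow γ n) = n * loopClass e γ := by
  induction n with
  | zero => rw [loopPow, loopClass_refl, Nat.cast_zero, zero_mul]
  | succ n ih => rw [loopPow, loopClass_trans, ih]; push_cast; ring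

variable [PathConnectedSpace X]

/-- A path is closed up to a loop at `x` by chosen paths from `x`, and evaluated there. -/
def pathClass {y z : X} (γ : Path y z) : ZMod p :=
  loopClass e (((PathConnectedSpace.somePath x y).trans γ).trans
    (PathConnectedSpace.somePath x z).symm)

lemma pathClass_trans {a b c : X} (γ : Path a b) (γ' : Path b c) :
    pathClass e (γ.trans γ') = pathClass e γ + pathClass e γ' := by
  rw [pathClass, pathClass, pathClass, ← loopClass_trans, loopClass_eq_iff,
    ← Path.Homotopic.Quotient.eq]
  have h (P : Path.Homotopic.Quotient x b) {c : X} (Q : Path.Homotopic.Quotient b c) :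
      P.symm.trans (P.trans Q) = Q := by
    rw [← Path.Homotopic.Quotient.trans_assoc]
    simp
  simp [h]

lemma pathClass_congr {a b : X} {γ γ' : Path a b} (h : γ.Homotopic γ') :
    pathClass e γ = pathClass e γ' :=
  (loopClass_eq_iff e).2 (((Path.Homotopic.refl _).hcomp h).hcomp (Path.Homotopic.refl _))

/-- The chosen path from x to x need not be constant, but its contribution cancels in the
commutative group ℤ/p. -/
lemma pathClass_loop (γ : Path x x) : pathClass e γ = loopClass e γ := by
  have h : loopClass e (PathConnectedSpace.somePath x x) +
      loopClass e (PathConnectedSpace.somePath x x).symm = 0 := by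
    rw [← loopClass_trans, ← loopClass_refl e, loopClass_eq_iff]
    exact ⟨(Path.Homotopy.reflTransSymm _).symm⟩
  rw [pathClass, loopClass_trans, loopClass_trans]
  linear_combination h

/-- The `1`-cochain `pathClass`. -/
def fundamentalCochain : Cochain (Sing X) (ZMod p) 1 := fun τ =>
  pathClass e (exists_path τ).choose_spec.choose_spec.choose

lemma fundamentalCochain_pathSimplex {a b : X} (γ : Path a b) :
    fundamentalCochain e (pathSimplex γ) = pathClass e γ := by
  have key : ∀ {a' b' : X} (γ' : Path a' b'), pathSimplex γ = pathSimplex γ' →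
      pathClass e γ' = pathClass e γ := by
    intro a' b' γ' h
    obtain ⟨rfl, rfl, h⟩ := pathSimplex_heq h
    rw [eq_of_heq h]
  exact key _ (exists_path (pathSimplex γ)).choose_spec.choose_spec.choose_spec

lemma fundamentalCochain_triangle (σ : (Sing X).obj (op (SimplexCategory.mk 2))) :
    fundamentalCochain e ((Sing X).δ 1 σ) =
      fundamentalCochain e ((Sing X).δ 2 σ) + fundamentalCochain e ((Sing X).δ 0 σ) := by
  obtain ⟨a, b, c, γ, γ', γ'', h2, h0, h1, h⟩ := exists_triangle σ
  rw [h0, h1, h2, fundamentalCochain_pathSimplex, fundamentalCochain_pathSimplex,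
    fundamentalCochain_pathSimplex, ← pathClass_trans, pathClass_congr e h]

/-- Closed up at x, γ becomes homotopic to a power of g, because `e` is injective. Reversed paths
supply the inverses needed to solve for the value at γ, although G is only a monoid. -/
lemma IsMulCocycle.factor [NeZero p] {G : Type v} [Monoid G]
    {f : (Sing X).obj (op (SimplexCategory.mk 1)) → G} (hf : IsMulCocycle f) {g : Path x x}
    (hg : loopClass e g = 1) {y z : X} (γ : Path y z) :
    f (pathSimplex γ) = f (pathSimplex (PathConnectedSpace.somePath x y).symm) *
      f (pathSimplex g) ^ (pathClass e γ).val * f (pathSimplex (PathConnectedSpace.somePath x z)) := by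
  have h : ((((PathConnectedSpace.somePath x y).trans γ).trans
      (PathConnectedSpace.somePath x z).symm)).Homotopic (MasseyPower.loopPow g (pathClass e γ).val) := by
    rw [← loopClass_eq_iff e, loopClass_loopPow, hg, mul_one, ZMod.natCast_zmod_val]
    rfl
  rw [← hf.loopPow, ← hf.homotopic h, hf.trans, hf.trans]
  simp only [mul_assoc]
  rw [hf.symm_mul, mul_one, ← mul_assoc, hf.symm_mul, one_mul]

end Loops

/-! ### The first cohomology group -/

section DegreeOne

variable {X : Type u} [TopologicalSpace X]

/-- A function that is multiplicative along singular triangles is idempotent on constant paths. -/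
lemma refl_mul_refl {G : Type v} [Mul G] {f : (Sing X).obj (op (SimplexCategory.mk 1)) → G}
    (h : ∀ σ, f ((Sing X).δ 1 σ) = f ((Sing X).δ 2 σ) * f ((Sing X).δ 0 σ)) (y : X) :
    f (pathSimplex (Path.refl y)) * f (pathSimplex (Path.refl y)) =
      f (pathSimplex (Path.refl y)) := by
  have hq (i : Fin 3) : (Sing X).δ i (simplexOf (n := 2) (ContinuousMap.const _ y)) =
      pathSimplex (Path.refl y) := δ_simplexOf_eq_pathSimplex _ _ i fun _ => rfl
  have := h (simplexOf (n := 2) (ContinuousMap.const _ y))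
  rw [hq, hq, hq] at this
  exact this.symm

lemma cls_eq_cls_iff {S : SSet.{u}} {A : Type v} [CommRing A] {n : ℕ} {a b : cocycles S A n} :
    cls a = cls b ↔ a.1 - b.1 ∈ coboundaries S A n := by
  rw [cls, cls, Submodule.Quotient.eq]
  rfl

lemma cls_eq_zero_iff {S : SSet.{u}} {A : Type v} [CommRing A] {n : ℕ} {a : cocycles S A n} :
    cls a = 0 ↔ a.1 ∈ coboundaries S A n := by
  rw [cls, Submodule.Quotient.mk_eq_zero]
  rfl

lemma cls_surjective {S : SSet.{u}} {A : Type v} [CommRing A] {n : ℕ} (T : H S A n) :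
    ∃ a : cocycles S A n, cls a = T := Submodule.Quotient.mk_surjective _ T

lemma d_zero_apply {S : SSet.{u}} {A : Type v} [CommRing A] (h : Cochain S A 0)
    (τ : S.obj (op (SimplexCategory.mk 1))) : d S A 0 h τ = h (S.δ 0 τ) - h (S.δ 1 τ) := by
  simp [d, Fin.sum_univ_succ]
  ring

lemma mem_cocycles_one_iff {S : SSet.{u}} {A : Type v} [CommRing A] {z : Cochain S A 1} :
    z ∈ cocycles S A 1 ↔ ∀ σ, z (S.δ 1 σ) = z (S.δ 2 σ) + z (S.δ 0 σ) := by
  rw [cocycles, LinearMap.mem_ker, funext_iff]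
  refine forall_congr' fun σ => ?_
  rw [d_one_apply, Pi.zero_apply]
  constructor <;> intro h <;> linear_combination -h

lemma coboundary_loop {A : Type v} [CommRing A] {b : Cochain (Sing X) A 1}
    (hb : b ∈ coboundaries (Sing X) A 1) {x : X} (γ : Path x x) : b (pathSimplex γ) = 0 := by
  obtain ⟨h, rfl⟩ := hb
  rw [d_zero_apply, δ_zero_pathSimplex, δ_one_pathSimplex, sub_self]

lemma loop_eq_of_cls_eq {A : Type v} [CommRing A] {a b : cocycles (Sing X) A 1}
    (h : cls a = cls b) {x : X} (γ : Path x x) : a.1 (pathSimplex γ) = b.1 (pathSimplex γ) :=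
  sub_eq_zero.1 (coboundary_loop (cls_eq_cls_iff.1 h) γ)

/-- The condition on constant paths is automatic: an idempotent of a group is trivial. -/
lemma isMulCocycle_ofAdd {A : Type v} [CommRing A] {z : Cochain (Sing X) A 1}
    (hz : z ∈ cocycles (Sing X) A 1) : IsMulCocycle fun τ => Multiplicative.ofAdd (z τ) := by
  rw [mem_cocycles_one_iff] at hz
  have h : ∀ σ, Multiplicative.ofAdd (z ((Sing X).δ 1 σ)) =
      Multiplicative.ofAdd (z ((Sing X).δ 2 σ)) * Multiplicative.ofAdd (z ((Sing X).δ 0 σ)) :=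
    fun σ => congrArg Multiplicative.ofAdd (hz σ)
  exact ⟨h, fun y => mul_eq_right.1 (refl_mul_refl h y)⟩

variable {p : ℕ} {x : X} (e : FundamentalGroup X x ≃* Multiplicative (ZMod p))
  [PathConnectedSpace X]

/-- The cocycle `pathClass`. -/
def fundamentalCocycle : cocycles (Sing X) (ZMod p) 1 :=
  ⟨fundamentalCochain e, mem_cocycles_one_iff.2 (fundamentalCochain_triangle e)⟩

/-- The class in `H¹` whose evaluation on loops is the given isomorphism. -/
def fundamentalClass : H (Sing X) (ZMod p) 1 := cls (fundamentalCocycle e)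

lemma fundamentalClass_loop {a : cocycles (Sing X) (ZMod p) 1} (h : cls a = fundamentalClass e)
    (γ : Path x x) : a.1 (pathSimplex γ) = loopClass e γ := by
  rw [loop_eq_of_cls_eq h γ, ← pathClass_loop]
  exact fundamentalCochain_pathSimplex e γ

lemma cls_eq_smul_fundamentalClass [NeZero p] {g : Path x x} (hg : loopClass e g = 1)
    (z : cocycles (Sing X) (ZMod p) 1) :
    cls z = z.1 (pathSimplex g) • fundamentalClass e := by
  have hz := isMulCocycle_ofAdd z.2
  change _ = cls (z.1 (pathSimplex g) • fundamentalCocycle e)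
  rw [cls_eq_cls_iff]
  -- The primitive integrates z along the chosen path from x to v.
  refine ⟨fun v => z.1 (pathSimplex (PathConnectedSpace.somePath x
    (TopCat.toSSetObj₀Equiv (X := TopCat.of X) v))), ?_⟩
  funext τ
  obtain ⟨a, b, γ, rfl⟩ := exists_path τ
  rw [d_zero_apply, δ_zero_pathSimplex, δ_one_pathSimplex, Equiv.apply_symm_apply,
    Equiv.apply_symm_apply]
  have h1 := congrArg Multiplicative.toAdd (hz.factor e hg γ)
  have h2 := congrArg Multiplicative.toAdd (hz.mul_symm (PathConnectedSpace.somePath x a))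
  simp only [toAdd_mul, toAdd_pow, toAdd_ofAdd, toAdd_one, nsmul_eq_mul,
    ZMod.natCast_zmod_val] at h1 h2
  have h3 : (z.1 - (z.1 (pathSimplex g) • fundamentalCocycle e).1) (pathSimplex γ) =
      z.1 (pathSimplex γ) - z.1 (pathSimplex g) * pathClass e γ := by
    rw [← fundamentalCochain_pathSimplex]
    rfl
  rw [h3]
  linear_combination -h2 - h1

lemma span_fundamentalClass [NeZero p] :
    Submodule.span (ZMod p) {fundamentalClass e} = ⊤ := by
  obtain ⟨g, hg⟩ := exists_loopClass_eq e 1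
  rw [eq_top_iff]
  rintro T -
  obtain ⟨z, rfl⟩ := cls_surjective T
  rw [cls_eq_smul_fundamentalClass e hg z]
  exact Submodule.smul_mem _ _ (Submodule.mem_span_singleton_self _)

lemma loop_ne_zero_of_span_eq_top [NeZero p] [Nontrivial (ZMod p)]
    {a : cocycles (Sing X) (ZMod p) 1}
    (h : Submodule.span (ZMod p) {cls a} = ⊤) {g : Path x x} (hg : loopClass e g = 1) :
    a.1 (pathSimplex g) ≠ 0 := by
  intro h0
  rw [cls_eq_smul_fundamentalClass e hg, h0, zero_smul, Submodule.span_zero_singleton] at h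
  have h1 : fundamentalClass e = 0 := by
    rw [← Submodule.mem_bot (ZMod p), h]
    trivial
  have h2 := coboundary_loop (cls_eq_zero_iff.1 h1) g
  have h3 := fundamentalClass_loop e rfl g
  rw [hg] at h3
  exact one_ne_zero (h3.symm.trans h2)

end DegreeOne

/-! ### Unitriangular matrices modulo the corner -/

section Unitriangular

variable {R : Type v} [CommRing R] {n : ℕ}

/-- Upper triangular matrices with unit diagonal. -/
def IsUnitriangular (A : Matrix (Fin n) (Fin n) R) : Prop :=
  A.BlockTriangular id ∧ ∀ i, A i i = 1

lemma mul_apply_of_blockTriangular {A B : Matrix (Fin n) (Fin n) R} (hA : A.BlockTriangular id)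
    (hB : B.BlockTriangular id) {i j : Fin n} (h : i < j) :
    (A * B) i j = A i i * B i j + A i j * B j j + ∑ k ∈ Finset.Ioo i j, A i k * B k j := by
  rw [Matrix.mul_apply, ← Finset.sum_subset (Finset.subset_univ (Finset.Icc i j)),
    ← Finset.Ico_insert_right h.le, ← Finset.Ioo_insert_left h, Finset.sum_insert (by simp [h.ne']),
    Finset.sum_insert (by simp)]
  · ring
  · intro k _ hk
    rw [Finset.mem_Icc, not_and_or, not_le, not_le] at hk
    rcases hk with hk | hk
    · rw [hA hk, zero_mul]
    · rw [hB hk, mul_zero]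

lemma IsUnitriangular.one : IsUnitriangular (1 : Matrix (Fin n) (Fin n) R) :=
  ⟨Matrix.blockTriangular_one, fun _ => Matrix.one_apply_eq _⟩

lemma IsUnitriangular.mul {A B : Matrix (Fin n) (Fin n) R} (hA : IsUnitriangular A)
    (hB : IsUnitriangular B) : IsUnitriangular (A * B) := by
  refine ⟨hA.1.mul hB.1, fun i => ?_⟩
  rw [Matrix.mul_apply, Finset.sum_eq_single i, hA.2, hB.2, one_mul]
  · intro k _ hk
    rcases lt_or_gt_of_ne hk with hk | hk
    · rw [hA.1 hk, zero_mul]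
    · rw [hB.1 hk, mul_zero]
  · simp

lemma IsUnitriangular.pow {A : Matrix (Fin n) (Fin n) R} (hA : IsUnitriangular A) (k : ℕ) :
    IsUnitriangular (A ^ k) := by
  induction k with
  | zero => rw [pow_zero]; exact .one
  | succ k ih => rw [pow_succ]; exact ih.mul hA

lemma IsUnitriangular.eq_one_of_mul_self {A : Matrix (Fin n) (Fin n) R} (hA : IsUnitriangular A)
    (h : A * A = A) : A = 1 := by
  have hdet : IsUnit A := by
    rw [Matrix.isUnit_iff_isUnit_det, Matrix.det_of_isUpperTriangular hA.1]
    simp [hA.2]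
  exact hdet.mul_left_cancel (h.trans (mul_one A).symm)

lemma IsUnitriangular.submatrix {m : ℕ} {A : Matrix (Fin n) (Fin n) R} (hA : IsUnitriangular A)
    {f : Fin m → Fin n} (hf : StrictMono f) : IsUnitriangular (A.submatrix f f) :=
  ⟨fun _ _ h => hA.1 (hf h), fun _ => hA.2 _⟩

/-- The upper left and the lower right block of size `n` of a matrix of size `n + 1`: for upper
triangular matrices, everything except the upper right corner. -/
def blocks (A : Matrix (Fin (n + 1)) (Fin (n + 1)) R) :
    Matrix (Fin n) (Fin n) R × Matrix (Fin n) (Fin n) R :=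
  (A.submatrix Fin.castSucc Fin.castSucc, A.submatrix Fin.succ Fin.succ)

lemma blocks_one : blocks (1 : Matrix (Fin (n + 1)) (Fin (n + 1)) R) = 1 := by
  rw [blocks, Matrix.submatrix_one _ (Fin.castSucc_injective n),
    Matrix.submatrix_one _ (Fin.succ_injective n)]
  rfl

/-- Triangularity kills the one summand of the full product that each block product omits. -/
lemma blocks_mul {A B : Matrix (Fin (n + 1)) (Fin (n + 1)) R} (hA : A.BlockTriangular id)
    (hB : B.BlockTriangular id) : blocks (A * B) = blocks A * blocks B := by
  refine Prod.ext ?_ ?_ <;> ext i j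
  · simp only [blocks, Matrix.submatrix_apply, Prod.fst_mul, Matrix.mul_apply]
    rw [Fin.sum_univ_castSucc, show B (Fin.last n) j.castSucc = 0 from hB (Fin.castSucc_lt_last j),
      mul_zero, add_zero]
  · simp only [blocks, Matrix.submatrix_apply, Prod.snd_mul, Matrix.mul_apply]
    rw [Fin.sum_univ_succ, show A i.succ 0 = 0 from hA (Fin.succ_pos i), zero_mul, zero_add]

lemma blocks_pow {A : Matrix (Fin (n + 1)) (Fin (n + 1)) R} (hA : IsUnitriangular A) (k : ℕ) :
    blocks (A ^ k) = blocks A ^ k := by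
  induction k with
  | zero => rw [pow_zero, pow_zero, blocks_one]
  | succ k ih => rw [pow_succ, pow_succ, blocks_mul (hA.pow k).1 hA.1, ih]

/-- The matrix unit in the upper right corner. -/
def corner (n : ℕ) (R : Type v) [CommRing R] : Matrix (Fin (n + 1)) (Fin (n + 1)) R :=
  Matrix.single 0 (Fin.last n) 1

lemma apply_eq_of_blocks_eq {S : Type v} {A B : Matrix (Fin (n + 1)) (Fin (n + 1)) S}
    (h : blocks A = blocks B)
    {i j : Fin (n + 1)} (hij : i < j) (h0 : ¬(i = 0 ∧ j = Fin.last n)) : A i j = B i j := by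
  by_cases hj : j = Fin.last n
  · have hi : i ≠ 0 := fun hi => h0 ⟨hi, hj⟩
    obtain ⟨i, rfl⟩ := Fin.exists_succ_eq.2 hi
    obtain ⟨j, rfl⟩ := Fin.exists_succ_eq.2 (Fin.ne_zero_of_lt hij)
    exact congrFun (congrFun (congrArg Prod.snd h) i) j
  · obtain ⟨j, rfl⟩ := Fin.exists_castSucc_eq.2 hj
    obtain ⟨i, rfl⟩ := Fin.exists_castSucc_eq.2 (Fin.ne_last_of_lt hij)
    exact congrFun (congrFun (congrArg Prod.fst h) i) j

lemma eq_add_smul_corner {A B : Matrix (Fin (n + 1)) (Fin (n + 1)) R} (hA : IsUnitriangular A)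
    (hB : IsUnitriangular B) (h : blocks A = blocks B) : ∃ c : R, A = B + c • corner n R := by
  refine ⟨A 0 (Fin.last n) - B 0 (Fin.last n), ?_⟩
  ext i j
  rw [Matrix.add_apply, Matrix.smul_apply, corner]
  by_cases h0 : i = 0 ∧ j = Fin.last n
  · obtain ⟨rfl, rfl⟩ := h0
    simp
  · rw [Matrix.single_apply_of_ne _ _ _ _ _ fun hh => h0 ⟨hh.1.symm, hh.2.symm⟩, smul_zero,
      add_zero]
    rcases lt_trichotomy i j with hij | rfl | hij
    · exact apply_eq_of_blocks_eq h hij h0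
    · rw [hA.2, hB.2]
    · rw [hA.1 hij, hB.1 hij]

/-- With `corner_mul`, this makes the corner central, so corner errors can be pulled out of any
product. -/
lemma IsUnitriangular.mul_corner {A : Matrix (Fin (n + 1)) (Fin (n + 1)) R}
    (hA : IsUnitriangular A) : A * corner n R = corner n R := by
  ext i j
  by_cases hj : j = Fin.last n
  · subst hj
    rw [corner, Matrix.mul_single_apply_same, mul_one]
    by_cases hi : i = 0
    · rw [hi, hA.2, Matrix.single_apply_same]
    · rw [hA.1 (Fin.pos_of_ne_zero hi), Matrix.single_apply_of_ne _ _ _ _ _ fun h => hi h.1.symm]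
  · rw [corner, Matrix.mul_single_apply_of_ne _ _ _ _ _ hj,
      Matrix.single_apply_of_ne _ _ _ _ _ fun h => hj h.2.symm]

lemma IsUnitriangular.corner_mul {A : Matrix (Fin (n + 1)) (Fin (n + 1)) R}
    (hA : IsUnitriangular A) : corner n R * A = corner n R := by
  ext i j
  by_cases hi : i = 0
  · subst hi
    rw [corner, Matrix.single_mul_apply_same, one_mul]
    by_cases hj : j = Fin.last n
    · rw [hj, hA.2, Matrix.single_apply_same]
    · rw [show A (Fin.last n) j = 0 from hA.1 (Fin.lt_last_iff_ne_last.2 hj),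
        Matrix.single_apply_of_ne _ _ _ _ _ fun h => hj h.2.symm]
  · rw [corner, Matrix.single_mul_apply_of_ne _ _ _ _ _ hi,
      Matrix.single_apply_of_ne _ _ _ _ _ fun h => hi h.1.symm]

lemma corner_mul_corner (hn : n ≠ 0) : corner n R * corner n R = 0 :=
  Matrix.single_mul_single_of_ne _ _ _ _ (by simpa [Fin.ext_iff] using hn) _

lemma one_add_smul_corner_pow (hn : n ≠ 0) (c : R) (k : ℕ) :
    (1 + c • corner n R) ^ k = 1 + (k * c) • corner n R := by
  induction k with
  | zero => simp
  | succ k ih =>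
    rw [pow_succ, ih, mul_add, mul_one, add_mul, one_mul, smul_mul_smul_comm,
      corner_mul_corner hn, smul_zero, add_zero, add_assoc, ← add_smul]
    push_cast
    ring_nf

lemma IsUnitriangular.add_smul_corner (hn : n ≠ 0) {A : Matrix (Fin (n + 1)) (Fin (n + 1)) R}
    (hA : IsUnitriangular A) (c : R) : IsUnitriangular (A + c • corner n R) := by
  constructor
  · intro i j hij
    rw [Matrix.add_apply, Matrix.smul_apply, hA.1 hij, corner,
      Matrix.single_apply_of_ne _ _ _ _ _, smul_zero, zero_add]
    rintro ⟨rfl, rfl⟩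
    exact absurd hij (Fin.not_lt_zero _)
  · intro i
    rw [Matrix.add_apply, Matrix.smul_apply, hA.2, corner,
      Matrix.single_apply_of_ne _ _ _ _ _, smul_zero, add_zero]
    rintro ⟨rfl, h⟩
    exact hn (by simpa [Fin.ext_iff] using h)

lemma blocks_add_smul_corner (A : Matrix (Fin (n + 1)) (Fin (n + 1)) R) (c : R) :
    blocks (A + c • corner n R) = blocks A := by
  refine Prod.ext ?_ ?_ <;> ext i j <;>
    simp only [blocks, Matrix.submatrix_apply, Matrix.add_apply, Matrix.smul_apply, corner]
  · rw [Matrix.single_apply_of_ne _ _ _ _ _ fun h => (Fin.castSucc_lt_last j).ne h.2.symm,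
      smul_zero, add_zero]
  · rw [Matrix.single_apply_of_ne _ _ _ _ _ fun h => (Fin.succ_ne_zero i) h.1.symm,
      smul_zero, add_zero]

/-- The unitriangular matrix `1 - a` attached to a family `a i j`, `i < j`. -/
def unitri (a : Fin n → Fin n → R) : Matrix (Fin n) (Fin n) R :=
  Matrix.of fun i j => if i < j then -a i j else if i = j then 1 else 0

lemma unitri_of_lt (a : Fin n → Fin n → R) {i j : Fin n} (h : i < j) : unitri a i j = -a i j :=
  if_pos h

lemma isUnitriangular_unitri (a : Fin n → Fin n → R) : IsUnitriangular (unitri a) := by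
  constructor
  · intro i j (hij : j < i)
    simp [unitri, hij.not_gt, hij.ne']
  · intro i
    simp [unitri]

lemma unitri_mul_apply (a b : Fin n → Fin n → R) {i j : Fin n} (h : i < j) :
    (unitri a * unitri b) i j = -b i j - a i j + ∑ k ∈ Finset.Ioo i j, a i k * b k j := by
  rw [mul_apply_of_blockTriangular (isUnitriangular_unitri a).1 (isUnitriangular_unitri b).1 h,
    (isUnitriangular_unitri a).2, (isUnitriangular_unitri b).2, unitri_of_lt _ h,
    unitri_of_lt _ h, Finset.sum_congr rfl fun k hk => ?_]
  · ring
  · rw [Finset.mem_Ioo] at hk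
    rw [unitri_of_lt _ hk.1, unitri_of_lt _ hk.2, neg_mul_neg]

lemma strictUpper_pow_apply {N : Matrix (Fin n) (Fin n) R} (hN : ∀ i j, j ≤ i → N i j = 0) {t : R}
    (ht : ∀ i j : Fin n, (j : ℕ) = i + 1 → N i j = t) (k : ℕ) (i j : Fin n) :
    ((j : ℕ) < i + k → (N ^ k) i j = 0) ∧ ((j : ℕ) = i + k → (N ^ k) i j = t ^ k) := by
  induction k generalizing j with
  | zero =>
    constructor
    · intro h
      exact Matrix.one_apply_ne (by rintro rfl; simp at h)
    · intro h
      obtain rfl : i = j := Fin.ext h.symm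
      rw [pow_zero, pow_zero, Matrix.one_apply_eq]
  | succ k ih =>
    rw [pow_succ, Matrix.mul_apply]
    constructor
    · intro h
      refine Finset.sum_eq_zero fun l _ => ?_
      by_cases hl : (l : ℕ) < i + k
      · rw [(ih l).1 hl, zero_mul]
      · rw [hN l j (Fin.le_def.2 (by omega)), mul_zero]
    · intro h
      have hj := j.2
      have hl : (i : ℕ) + k < n := by omega
      rw [Finset.sum_eq_single ⟨i + k, hl⟩, (ih _).2 rfl, ht _ _ (by simp only; omega), pow_succ]
      · intro l _ hne
        have hne' : (l : ℕ) ≠ i + k := fun h => hne (Fin.ext h)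
        rcases lt_or_gt_of_ne hne' with h' | h'
        · rw [(ih l).1 h', zero_mul]
        · rw [hN l j (Fin.le_def.2 (by omega)), mul_zero]
      · simp

/-- In characteristic `p ≥ n`, the `p`-th power of a unitriangular matrix of size `n + 1` with
constant superdiagonal. -/
lemma unitri_pow_char (p : ℕ) [Fact p.Prime] [CharP R p] (hn : n ≤ p)
    {a : Fin (n + 1) → Fin (n + 1) → R} {t : R}
    (ha : ∀ i : Fin n, a i.castSucc i.succ = t) :
    unitri a ^ p = 1 + (if n = p then -t ^ p else 0) • corner n R := by
  set N : Matrix (Fin (n + 1)) (Fin (n + 1)) R := 1 - unitri a with hN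
  have h1 : ∀ i j, j ≤ i → N i j = 0 := by
    intro i j hij
    rcases hij.eq_or_lt with rfl | hij
    · rw [hN, Matrix.sub_apply, Matrix.one_apply_eq, (isUnitriangular_unitri a).2, sub_self]
    · rw [hN, Matrix.sub_apply, Matrix.one_apply_ne hij.ne', (isUnitriangular_unitri a).1 hij,
        sub_self]
  have h2 : ∀ i j : Fin (n + 1), (j : ℕ) = i + 1 → N i j = t := by
    intro i j hij
    have hj := j.2
    have hi : (i : ℕ) < n := by omega
    have hlt : i < j := Fin.lt_def.2 (by omega)
    obtain rfl : j = (⟨i, hi⟩ : Fin n).succ := Fin.ext hij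
    rw [hN, Matrix.sub_apply, Matrix.one_apply_ne hlt.ne, unitri_of_lt _ hlt, ← ha ⟨i, hi⟩,
      zero_sub, neg_neg]
    rfl
  have h3 : unitri a = 1 - N := by rw [hN, sub_sub_cancel]
  -- Only entries with j ≥ i + p survive in N ^ p; as n ≤ p, that leaves at most the corner, and
  -- only for n = p.
  rw [h3, sub_pow_char_of_commute p (Commute.one_left N), one_pow, sub_eq_add_neg]
  congr 1
  ext i j
  have key := strictUpper_pow_apply h1 h2 p i j
  have hj := j.2
  rw [Matrix.neg_apply, Matrix.smul_apply, corner]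
  by_cases hc : (j : ℕ) = i + p
  · have hnp : n = p := by omega
    subst hnp
    have hi : i = 0 := Fin.ext (by rw [Fin.val_zero]; omega)
    have hj : j = Fin.last n := Fin.ext (by rw [Fin.val_last]; omega)
    rw [key.2 hc, hi, hj, Matrix.single_apply_same, if_pos rfl, smul_eq_mul, mul_one]
  · rw [key.1 (by omega), neg_zero]
    split_ifs with hnp
    · rw [Matrix.single_apply_of_ne, smul_zero]
      rintro ⟨rfl, rfl⟩
      exact hc (by simp [hnp])
    · rw [zero_smul]

end Unitriangular

/-! ### The value as an obstruction to lifting over the corner -/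

section Obstruction

lemma blocks_eq_of_apply_eq {R : Type v} [CommRing R] {n : ℕ}
    {A B : Matrix (Fin (n + 1)) (Fin (n + 1)) R}
    (hA : IsUnitriangular A) (hB : IsUnitriangular B)
    (h : ∀ i j, i < j → ¬(i = 0 ∧ j = Fin.last n) → A i j = B i j) : blocks A = blocks B := by
  have h' : ∀ i j, ¬(i = 0 ∧ j = Fin.last n) → A i j = B i j := by
    intro i j h0
    rcases lt_trichotomy i j with hij | rfl | hij
    · exact h i j hij h0
    · rw [hA.2, hB.2]
    · rw [hA.1 hij, hB.1 hij]
  refine Prod.ext ?_ ?_ <;> ext i j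
  · exact h' _ _ fun hh => (Fin.castSucc_lt_last j).ne hh.2
  · exact h' _ _ fun hh => Fin.succ_ne_zero i hh.1

/-- The sign in 1 - a is chosen so that the Massey equation becomes multiplicativity along the
triangle. -/
lemma unitri_mul_apply_of_d_eq {S : SSet.{u}} {R : Type v} [CommRing R] {n : ℕ}
    {a : Fin n → Fin n → Cochain S R 1} {i j : Fin n} (hij : i < j)
    (h : d S R 1 (a i j) = ∑ k ∈ Finset.Ioo i j, cup (a i k) (a k j))
    (σ : S.obj (op (SimplexCategory.mk 2))) :
    (unitri (fun i j => a i j (S.δ 2 σ)) * unitri fun i j => a i j (S.δ 0 σ)) i j =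
      unitri (fun i j => a i j (S.δ 1 σ)) i j := by
  have h' := congrFun h σ
  rw [d_one_apply, Finset.sum_apply] at h'
  simp only [cup_one_one_apply] at h'
  rw [unitri_mul_apply _ _ hij, unitri_of_lt _ hij, ← h']
  ring

variable {X : Type u} [TopologicalSpace X]

lemma DefiningSystem.isMulCocycle_blocks {R : Type v} [CommRing R] {n : ℕ}
    {u : Fin n → H (Sing X) R 1} (D : DefiningSystem n u) :
    IsMulCocycle fun τ => blocks (unitri fun i j => D.a i j τ) := by
  have h : ∀ σ, blocks (unitri fun i j => D.a i j ((Sing X).δ 1 σ)) =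
      blocks (unitri fun i j => D.a i j ((Sing X).δ 2 σ)) *
        blocks (unitri fun i j => D.a i j ((Sing X).δ 0 σ)) := by
    intro σ
    rw [← blocks_mul (isUnitriangular_unitri _).1 (isUnitriangular_unitri _).1]
    refine blocks_eq_of_apply_eq (isUnitriangular_unitri _)
      ((isUnitriangular_unitri _).mul (isUnitriangular_unitri _)) fun i j hij h0 => ?_
    exact (unitri_mul_apply_of_d_eq hij (D.d_eq i j hij h0) σ).symm
  refine ⟨h, fun y => ?_⟩
  have hy := refl_mul_refl (f := fun τ => blocks (unitri fun i j => D.a i j τ)) h y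
  have hU := isUnitriangular_unitri fun i j => D.a i j (pathSimplex (Path.refl y))
  refine Prod.ext ?_ ?_
  · exact (hU.submatrix Fin.strictMono_castSucc).eq_one_of_mul_self (congrArg Prod.fst hy)
  · exact (hU.submatrix (Fin.strictMono_succ (n := n))).eq_one_of_mul_self (congrArg Prod.snd hy)

lemma DefiningSystem.superdiagonal_loop {R : Type v} [CommRing R] {n : ℕ}
    {z : cocycles (Sing X) R 1} (D : DefiningSystem n fun _ => cls z) {x : X} (g : Path x x)
    (i : Fin n) : D.a i.castSucc i.succ (pathSimplex g) = z.1 (pathSimplex g) := by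
  obtain ⟨w, hw, hcls⟩ := D.rep i
  rw [← hw, loop_eq_of_cls_eq hcls]

variable {p : ℕ} [Fact p.Prime] {x : X}

/-- The value of a defining system for the `p`-fold Massey power of a class which is nonzero on a
loop of order `p` is not a coboundary. -/
theorem DefiningSystem.value_ne_zero
    (e : FundamentalGroup X x ≃* Multiplicative (ZMod p)) {z : cocycles (Sing X) (ZMod p) 1}
    (D : DefiningSystem p fun _ => cls z) {g : Path x x} (hg : z.1 (pathSimplex g) ≠ 0) :
    D.value ≠ 0 := by
  intro h0
  obtain ⟨b, hb⟩ := cls_eq_zero_iff.1 h0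
  have hp : p ≠ 0 := (Fact.out : p.Prime).ne_zero
  have hpos : (0 : Fin (p + 1)) < Fin.last p := Fin.lt_def.2 (by simpa using Nat.pos_of_ne_zero hp)
  -- Fill the missing corner with the primitive b. The corner never occurs as a factor in the sums,
  -- so all other equations persist.
  let a (i j : Fin (p + 1)) : Cochain (Sing X) (ZMod p) 1 :=
    if i = 0 ∧ j = Fin.last p then b else D.a i j
  have ha {i j : Fin (p + 1)} (h : ¬(i = 0 ∧ j = Fin.last p)) : a i j = D.a i j := if_neg h
  have hd (i j : Fin (p + 1)) (hij : i < j) :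
      d (Sing X) (ZMod p) 1 (a i j) = ∑ k ∈ Finset.Ioo i j, cup (a i k) (a k j) := by
    have hsum : ∀ k ∈ Finset.Ioo i j, cup (a i k) (a k j) = cup (D.a i k) (D.a k j) := by
      intro k hk
      rw [Finset.mem_Ioo] at hk
      rw [ha fun h => (hk.2.trans_le (Fin.le_last j)).ne h.2,
        ha fun h => Fin.not_lt_zero _ (h.1 ▸ hk.1)]
    rw [Finset.sum_congr rfl hsum]
    by_cases h : i = 0 ∧ j = Fin.last p
    · obtain ⟨rfl, rfl⟩ := h
      rw [show a 0 (Fin.last p) = b from if_pos ⟨rfl, rfl⟩, hb]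
      rfl
    · rw [ha h, D.d_eq i j hij h]
  have htri : ∀ σ, (unitri fun i j => a i j ((Sing X).δ 1 σ)) =
      (unitri fun i j => a i j ((Sing X).δ 2 σ)) * unitri fun i j => a i j ((Sing X).δ 0 σ) := by
    intro σ
    have h1 := isUnitriangular_unitri fun i j => a i j ((Sing X).δ 1 σ)
    have h2 := (isUnitriangular_unitri fun i j => a i j ((Sing X).δ 2 σ)).mul
      (isUnitriangular_unitri fun i j => a i j ((Sing X).δ 0 σ))
    ext i j
    rcases lt_trichotomy i j with hij | rfl | hij
    · exact (unitri_mul_apply_of_d_eq hij (hd i j hij) σ).symm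
    · rw [h1.2, h2.2]
    · rw [h1.1 hij, h2.1 hij]
  have hmul : IsMulCocycle fun τ => unitri fun i j => a i j τ :=
    ⟨htri, fun y => (isUnitriangular_unitri _).eq_one_of_mul_self
      (refl_mul_refl (f := fun τ => unitri fun i j => a i j τ) htri y)⟩
  -- The p-fold concatenation of g is null-homotopic.
  have hpow : (unitri fun i j => a i j (pathSimplex g)) ^ p = 1 := by
    rw [← hmul.loopPow g p, ← hmul.refl x]
    refine hmul.homotopic ((loopClass_eq_iff e).1 ?_)
    rw [loopClass_loopPow, loopClass_refl, CharP.cast_eq_zero, zero_mul]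
  have hp1 : 1 < p := (Fact.out : p.Prime).one_lt
  rw [unitri_pow_char p le_rfl (t := z.1 (pathSimplex g)) fun i => ?_, if_pos rfl] at hpow
  · have h := congrFun (congrFun hpow 0) (Fin.last p)
    rw [Matrix.add_apply, Matrix.one_apply_ne hpos.ne, Matrix.smul_apply, corner,
      Matrix.single_apply_same, smul_eq_mul, mul_one, zero_add, neg_eq_zero] at h
    exact hg (pow_eq_zero_iff hp |>.1 h)
  · rw [ha, D.superdiagonal_loop g i]
    rintro ⟨h1, h2⟩
    have h1' := congrArg Fin.val h1
    have h2' := congrArg Fin.val h2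
    rw [Fin.val_castSucc, Fin.val_zero] at h1'
    rw [Fin.val_succ, Fin.val_last] at h2'
    omega

variable (e : FundamentalGroup X x ≃* Multiplicative (ZMod p)) [PathConnectedSpace X]

/-- The carry in the addition of the values of `fundamentalCochain` on the edges of a triangle. -/
def carry : Cochain (Sing X) (ZMod p) 2 := fun σ =>
  (((fundamentalCochain e ((Sing X).δ 2 σ)).val + (fundamentalCochain e ((Sing X).δ 0 σ)).val) / p :
    ℕ)

/-- The value of a defining system is, up to a coboundary, a multiple of the carry cochain which
depends only on the class. -/
theorem DefiningSystem.valueCochain_eq {n : ℕ} (hn : n ≠ 0) (hnp : n ≤ p)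
    {z : cocycles (Sing X) (ZMod p) 1} (D : DefiningSystem n fun _ => cls z) {g : Path x x}
    (hg : loopClass e g = 1) : ∃ r : Cochain (Sing X) (ZMod p) 1,
      D.valueCochain = d (Sing X) (ZMod p) 1 r +
        (if n = p then -z.1 (pathSimplex g) ^ p else 0) • carry e := by
  set c := if n = p then -z.1 (pathSimplex g) ^ p else 0 with hc
  let E := corner n (ZMod p)
  let M (τ) := unitri fun i j => D.a i j τ
  have hM (τ) : IsUnitriangular (M τ) := isUnitriangular_unitri _
  have hmul : IsMulCocycle fun τ => blocks (M τ) := D.isMulCocycle_blocks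
  let pt (v : (Sing X).obj (op (SimplexCategory.mk 0))) : X :=
    TopCat.toSSetObj₀Equiv (X := TopCat.of X) v
  have hpt (y : X) : pt (pointSimplex y) = y := Equiv.apply_symm_apply _ _
  let Q (v) := M (pathSimplex (PathConnectedSpace.somePath x (pt v)))
  let P' (v) := M (pathSimplex (PathConnectedSpace.somePath x (pt v)).symm)
  have hP' (v) : ∃ k : ZMod p, Q v * P' v = 1 + k • E := by
    refine eq_add_smul_corner ((hM _).mul (hM _)) .one ?_
    rw [blocks_mul (hM _).1 (hM _).1, blocks_one]
    exact hmul.mul_symm _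
  choose k hk using hP'
  -- The matrix of the reversed path inverts `Q v` only modulo the corner; this correction makes it
  -- an exact inverse.
  let P (v) := P' v + (-k v) • E
  have hQ (v) : IsUnitriangular (Q v) := hM _
  have hP (v) : IsUnitriangular (P v) := (hM _).add_smul_corner hn _
  have hQP (v) : Q v * P v = 1 := by
    rw [mul_add, hk, mul_smul_comm, (hQ v).mul_corner, neg_smul, add_neg_cancel_right]
  let G := M (pathSimplex g)
  have hG : G ^ p = 1 + c • E :=
    unitri_pow_char p hnp fun i => D.superdiagonal_loop g i
  let L (τ) : ℕ := (fundamentalCochain e τ).val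
  let R (τ : (Sing X).obj (op (SimplexCategory.mk 1))) :=
    P ((Sing X).δ 1 τ) * G ^ L τ * Q ((Sing X).δ 0 τ)
  have hR (τ) : IsUnitriangular (R τ) := ((hP _).mul ((hM _).pow _)).mul (hQ _)
  have hRM (τ) : blocks (R τ) = blocks (M τ) := by
    obtain ⟨y, y', γ, rfl⟩ := exists_path τ
    rw [blocks_mul ((hP _).mul ((hM _).pow _)).1 (hQ _).1, blocks_mul (hP _).1 ((hM _).pow _).1,
      blocks_pow (hM _), blocks_add_smul_corner]
    refine Eq.trans ?_ (hmul.factor e hg γ).symm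
    have h1 : Q (pointSimplex y') = M (pathSimplex (PathConnectedSpace.somePath x y')) :=
      congrArg (fun v => M (pathSimplex (PathConnectedSpace.somePath x v))) (hpt y')
    have h2 : P' (pointSimplex y) = M (pathSimplex (PathConnectedSpace.somePath x y).symm) :=
      congrArg (fun v => M (pathSimplex (PathConnectedSpace.somePath x v).symm)) (hpt y)
    rw [δ_zero_pathSimplex, δ_one_pathSimplex, h1, h2]
    simp only [L, fundamentalCochain_pathSimplex]
  have hE {A B C : Matrix (Fin (n + 1)) (Fin (n + 1)) (ZMod p)} (hA : IsUnitriangular A)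
      (hB : IsUnitriangular B) (hC : IsUnitriangular C) (s : ZMod p) :
      A * ((1 + s • E) * B) * C = A * B * C + s • E := by
    rw [add_mul, one_mul, smul_mul_assoc, hB.corner_mul, mul_add, add_mul, mul_smul_comm,
      hA.mul_corner, smul_mul_assoc, hC.corner_mul]
  -- The inner factors Q and P cancel, leaving G to the sum of two residues in [0, p); each carry
  -- contributes a factor G ^ p = 1 + c • E.
  have hRR (σ : (Sing X).obj (op (SimplexCategory.mk 2))) :
      R ((Sing X).δ 2 σ) * R ((Sing X).δ 0 σ) =
        R ((Sing X).δ 1 σ) + (carry e σ * c) • E := by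
    have h01 : (Sing X).δ 1 ((Sing X).δ 0 σ) = (Sing X).δ 0 ((Sing X).δ 2 σ) :=
      SSet.δ_comp_δ_apply (S := Sing X) (n := 0) (i := 0) (j := 1) (by decide) σ |>.symm
    have h00 : (Sing X).δ 0 ((Sing X).δ 0 σ) = (Sing X).δ 0 ((Sing X).δ 1 σ) :=
      SSet.δ_comp_δ_apply (S := Sing X) (n := 0) (i := 0) (j := 0) (by decide) σ |>.symm
    have h11 : (Sing X).δ 1 ((Sing X).δ 1 σ) = (Sing X).δ 1 ((Sing X).δ 2 σ) :=
      SSet.δ_comp_δ_apply (S := Sing X) (n := 0) (i := 1) (j := 1) (by decide) σ |>.symm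
    have hL : L ((Sing X).δ 2 σ) + L ((Sing X).δ 0 σ) =
        p * ((L ((Sing X).δ 2 σ) + L ((Sing X).δ 0 σ)) / p) + L ((Sing X).δ 1 σ) := by
      have : L ((Sing X).δ 1 σ) = (L ((Sing X).δ 2 σ) + L ((Sing X).δ 0 σ)) % p := by
        simp only [L, fundamentalCochain_triangle, ZMod.val_add]
      rw [this, Nat.div_add_mod]
    have hcarry : ((((L ((Sing X).δ 2 σ) + L ((Sing X).δ 0 σ)) / p : ℕ) : ZMod p)) =
        carry e σ := rfl
    calc R ((Sing X).δ 2 σ) * R ((Sing X).δ 0 σ)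
        = P ((Sing X).δ 1 ((Sing X).δ 2 σ)) * (G ^ L ((Sing X).δ 2 σ) *
            (Q ((Sing X).δ 0 ((Sing X).δ 2 σ)) * P ((Sing X).δ 1 ((Sing X).δ 0 σ))) *
            G ^ L ((Sing X).δ 0 σ)) * Q ((Sing X).δ 0 ((Sing X).δ 0 σ)) := by
          simp only [R, mul_assoc]
      _ = R ((Sing X).δ 1 σ) + (carry e σ * c) • E := by
          rw [h01, hQP, mul_one, ← pow_add, hL, pow_add, pow_mul, hG, one_add_smul_corner_pow hn,
            hcarry, hE (hP _) ((hM _).pow _) (hQ _), h00, ← h11]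
  have hpos : (0 : Fin (n + 1)) < Fin.last n := Fin.lt_def.2 (by simpa using Nat.pos_of_ne_zero hn)
  -- Off the corner R is 1 - a, so the corner entry of `hRR` is the claim for this r.
  refine ⟨fun τ => -R τ 0 (Fin.last n), ?_⟩
  funext σ
  have h := congrFun (congrFun (hRR σ) 0) (Fin.last n)
  have hsum : ∀ k ∈ Finset.Ioo 0 (Fin.last n),
      R ((Sing X).δ 2 σ) 0 k * R ((Sing X).δ 0 σ) k (Fin.last n) =
        cup (D.a 0 k) (D.a k (Fin.last n)) σ := by
    intro k hk
    rw [Finset.mem_Ioo] at hk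
    have h1 (τ) : R τ 0 k = -D.a 0 k τ :=
      (apply_eq_of_blocks_eq (hRM τ) hk.1 fun h => hk.2.ne h.2).trans (unitri_of_lt _ hk.1)
    have h2 (τ) : R τ k (Fin.last n) = -D.a k (Fin.last n) τ :=
      (apply_eq_of_blocks_eq (hRM τ) hk.2 fun h => hk.1.ne' h.1).trans (unitri_of_lt _ hk.2)
    rw [h1, h2, neg_mul_neg, cup_one_one_apply]
  rw [mul_apply_of_blockTriangular (hR _).1 (hR _).1 hpos, (hR _).2, (hR _).2, Matrix.add_apply,
    Matrix.smul_apply, show E 0 (Fin.last n) = 1 from Matrix.single_apply_same _ _ _, smul_eq_mul,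
    Finset.sum_congr rfl hsum] at h
  rw [DefiningSystem.valueCochain, Finset.sum_apply, Pi.add_apply, d_one_apply, Pi.smul_apply,
    smul_eq_mul]
  linear_combination h

end Obstruction

/-! ### Defining systems from binomial coefficients -/

section Existence

open Polynomial

variable {p : ℕ} [Fact p.Prime]

/-- The coefficients of `(1 - X) ^ s`, for `s` modulo `p`. -/
def binomCoeff (s : ZMod p) (m : ℕ) : ZMod p := ((1 - X : (ZMod p)[X]) ^ s.val).coeff m

lemma binomCoeff_zero (s : ZMod p) : binomCoeff s 0 = 1 := by
  simp [binomCoeff, coeff_zero_eq_eval_zero]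

lemma binomCoeff_one (s : ZMod p) : binomCoeff s 1 = -s := by
  have h (k : ℕ) : ((1 - X : (ZMod p)[X]) ^ k).coeff 1 = -k := by
    induction k with
    | zero => simp [coeff_one]
    | succ k ih =>
      rw [pow_succ, mul_sub, mul_one, coeff_sub, ih, coeff_mul_X, coeff_zero_eq_eval_zero]
      simp
      ring
  rw [binomCoeff, h, ZMod.natCast_zmod_val]

/-- Since (1 - X) ^ p = 1 - X ^ p is 1 modulo X ^ p, coefficients below p see the exponent only
modulo p; the identity is then multiplication of polynomials. -/
lemma binomCoeff_add (s t : ZMod p) {m : ℕ} (hm : m < p) :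
    binomCoeff (s + t) m =
      ∑ ij ∈ Finset.HasAntidiagonal.antidiagonal m, binomCoeff s ij.1 * binomCoeff t ij.2 := by
  simp only [binomCoeff]
  rw [← coeff_mul, ← pow_add]
  have h : s.val + t.val = p * ((s.val + t.val) / p) + (s + t).val := by
    rw [ZMod.val_add, Nat.div_add_mod]
  obtain ⟨Q, hQ⟩ : (X ^ p : (ZMod p)[X]) ∣ (1 - X ^ p) ^ ((s.val + t.val) / p) - 1 := by
    have := sub_dvd_pow_sub_pow (1 - X ^ p : (ZMod p)[X]) 1 ((s.val + t.val) / p)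
    rw [one_pow] at this
    exact (Dvd.intro (-1) (by ring)).trans this
  rw [h, pow_add, pow_mul, sub_pow_char_of_commute p (Commute.one_left X), one_pow,
    eq_add_of_sub_eq hQ, add_mul, one_mul, mul_assoc,
    coeff_add, coeff_X_pow_mul', if_neg hm.not_ge, zero_add]

lemma sum_antidiagonal_eq_sum_Ioo {A : Type v} [AddCommMonoid A] {n : ℕ} {i j : Fin n} (h : i < j)
    (f : ℕ → ℕ → A) : ∑ ab ∈ Finset.HasAntidiagonal.antidiagonal ((j : ℕ) - i), f ab.1 ab.2 =
      f 0 (j - i) + (f (j - i) 0 + ∑ k ∈ Finset.Ioo i j, f (k - i) (j - k)) := by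
  have h1 : ∑ k ∈ Finset.Icc i j, f ((k : ℕ) - i) (j - k) =
      ∑ ab ∈ Finset.HasAntidiagonal.antidiagonal ((j : ℕ) - i), f ab.1 ab.2 := by
    refine Finset.sum_bij (fun k _ => ((k : ℕ) - i, (j : ℕ) - k)) ?_ ?_ ?_ fun _ _ => rfl
    · intro k hk
      rw [Finset.mem_Icc, Fin.le_def, Fin.le_def] at hk
      rw [Finset.HasAntidiagonal.mem_antidiagonal]
      omega
    · intro k hk l hl hkl
      rw [Finset.mem_Icc, Fin.le_def, Fin.le_def] at hk hl
      rw [Prod.mk.injEq] at hkl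
      exact Fin.ext (by omega)
    · rintro ⟨a, b⟩ hab
      rw [Finset.HasAntidiagonal.mem_antidiagonal] at hab
      have hj := j.2
      rw [Fin.lt_def] at h
      refine ⟨⟨i + a, by omega⟩, ?_, ?_⟩
      · rw [Finset.mem_Icc, Fin.le_def, Fin.le_def]
        simp only
        omega
      · rw [Prod.mk.injEq]
        simp only
        omega
  rw [← h1, ← Finset.Ico_insert_right h.le, ← Finset.Ioo_insert_left h,
    Finset.sum_insert (by simp [h.ne']), Finset.sum_insert (by simp), Nat.sub_self, Nat.sub_self,
    add_left_comm]

/-- The defining system of binomial type for a Massey power of length at most `p`. -/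
def binomialSystem {S : SSet.{u}} (z : cocycles S (ZMod p) 1) {n : ℕ} (hnp : n ≤ p) :
    DefiningSystem n fun _ => cls z where
  a i j τ := -binomCoeff (z.1 τ) (j - i)
  rep i := by
    refine ⟨z, ?_, rfl⟩
    funext τ
    rw [Fin.val_succ, Fin.val_castSucc, Nat.add_sub_cancel_left, binomCoeff_one, neg_neg]
  d_eq i j hij h0 := by
    funext σ
    -- Excluding the corner gives j - i < n ≤ p, even when n = p.
    have hm : (j : ℕ) - i < p := by
      have hj := j.2
      have hi : (i : ℕ) = 0 → (j : ℕ) ≠ n := fun h1 h2 => h0 ⟨Fin.ext h1, Fin.ext h2⟩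
      rw [Fin.lt_def] at hij
      omega
    rw [d_one_apply, mem_cocycles_one_iff.1 z.2, binomCoeff_add _ _ hm,
      sum_antidiagonal_eq_sum_Ioo hij fun a b =>
        binomCoeff (z.1 (S.δ 2 σ)) a * binomCoeff (z.1 (S.δ 0 σ)) b,
      binomCoeff_zero, binomCoeff_zero, Finset.sum_apply]
    simp only [cup_one_one_apply, neg_mul_neg]
    ring

end Existence

/-! ### Cup powers of a cocycle of degree one -/

section CupPowers

variable {S : SSet.{u}} {R : Type v} [CommRing R]

lemma map_op_map_op {a b c : SimplexCategory} (f : a ⟶ b) (g : b ⟶ c) (σ : S.obj (op c)) :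
    S.map f.op (S.map g.op σ) = S.map (f ≫ g).op σ := by
  rw [op_comp, S.map_comp]
  rfl

lemma simplexCategory_hom_ext {a b : ℕ} {f g : SimplexCategory.mk a ⟶ SimplexCategory.mk b}
    (h : ∀ k : Fin (a + 1), (f.toOrderHom k : ℕ) = g.toOrderHom k) : f = g :=
  SimplexCategory.Hom.ext _ _ (OrderHom.ext _ _ (funext fun k => Fin.ext (h k)))

lemma δ_toOrderHom_val {n : ℕ} (i : Fin (n + 2)) (k : Fin (n + 1)) :
    ((SimplexCategory.δ i).toOrderHom k : ℕ) = if (k : ℕ) < i then (k : ℕ) else k + 1 := by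
  change ((i.succAbove k : Fin (n + 2)) : ℕ) = _
  rw [Fin.succAbove]
  split_ifs with h1 h2 h2
  · rfl
  · exact absurd h1 h2
  · exact absurd h2 h1
  · rfl

lemma subinterval_comp_δ_val {n : ℕ} (j l : ℕ) (h : j + l ≤ n) (i : Fin (n + 2))
    (k : Fin (l + 1)) :
    ((SimplexCategory.subinterval j l h ≫ SimplexCategory.δ i).toOrderHom k : ℕ) =
      if (k : ℕ) + j < i then (k : ℕ) + j else k + j + 1 :=
  δ_toOrderHom_val i _

lemma δ_comp_subinterval_val {n : ℕ} (j l : ℕ) (h : j + (l + 1) ≤ n) (i : Fin (l + 2))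
    (k : Fin (l + 1)) :
    ((SimplexCategory.δ i ≫ SimplexCategory.subinterval j (l + 1) h).toOrderHom k : ℕ) =
      (if (k : ℕ) < i then (k : ℕ) else k + 1) + j :=
  congrArg (· + j) (δ_toOrderHom_val i k)

/-- The cup product of a cochain with a `1`-cocycle commutes with the coboundary. -/
lemma d_cup_cocycle {m : ℕ} (b : Cochain S R m) {z : Cochain S R 1} (hz : z ∈ cocycles S R 1) :
    d S R (m + 1) (cup b z) = cup (d S R m b) z := by
  funext σ
  have hface {a n : ℕ} (f : SimplexCategory.mk a ⟶ SimplexCategory.mk n) (i : Fin (n + 2))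
      (σ : S.obj (op (SimplexCategory.mk (n + 1)))) :
      S.map f.op (S.δ i σ) = S.map (f ≫ SimplexCategory.δ i).op σ := map_op_map_op _ _ _
  have hface' {a n : ℕ} (f : SimplexCategory.mk (a + 1) ⟶ SimplexCategory.mk n) (i : Fin (a + 2))
      (σ : S.obj (op (SimplexCategory.mk n))) :
      S.δ i (S.map f.op σ) = S.map (SimplexCategory.δ i ≫ f).op σ := map_op_map_op _ _ _
  have hL : d S R (m + 1) (cup b z) σ = ∑ i : Fin (m + 1 + 2), (-1) ^ (i : ℕ) *
      (b (S.map (SimplexCategory.subinterval 0 m (by omega) ≫ SimplexCategory.δ i).op σ) *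
        z (S.map (SimplexCategory.subinterval m 1 le_rfl ≫ SimplexCategory.δ i).op σ)) := by
    change ∑ i : Fin (m + 1 + 2), (-1) ^ (i : ℕ) * cup b z (S.δ i σ) = _
    refine Finset.sum_congr rfl fun i _ => ?_
    rw [← hface, ← hface]
    rfl
  have hR : cup (d S R m b) z σ = (∑ i : Fin (m + 2), (-1) ^ (i : ℕ) *
      b (S.map (SimplexCategory.δ i ≫
        SimplexCategory.subinterval (n := m + 1 + 1) 0 (m + 1) (by omega)).op σ)) *
        z (S.map (SimplexCategory.subinterval (n := m + 1 + 1) (m + 1) 1 le_rfl).op σ) := by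
    simp only [← hface']
    rfl
  have hlow (i : Fin (m + 1)) :
      SimplexCategory.subinterval 0 m (by omega) ≫ SimplexCategory.δ i.castSucc.castSucc =
        SimplexCategory.δ i.castSucc ≫
          SimplexCategory.subinterval (n := m + 1 + 1) 0 (m + 1) (by omega) := by
    refine simplexCategory_hom_ext fun k => ?_
    rw [subinterval_comp_δ_val, δ_comp_subinterval_val, Fin.val_castSucc, Fin.val_castSucc, add_zero,
      add_zero]
  have hedge (i : Fin (m + 1)) :
      SimplexCategory.subinterval m 1 le_rfl ≫ SimplexCategory.δ i.castSucc.castSucc =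
        SimplexCategory.subinterval (n := m + 1 + 1) (m + 1) 1 le_rfl := by
    refine simplexCategory_hom_ext fun k => ?_
    have hi := i.2
    rw [subinterval_comp_δ_val, Fin.val_castSucc, Fin.val_castSucc, if_neg (by omega)]
    exact add_assoc _ _ _
  have hfront (i : Fin (m + 3)) (hi : m < (i : ℕ)) :
      SimplexCategory.subinterval 0 m (by omega) ≫ SimplexCategory.δ i =
        SimplexCategory.subinterval (n := m + 1 + 1) 0 m (by omega) := by
    refine simplexCategory_hom_ext fun k => ?_
    have hk := k.2
    rw [subinterval_comp_δ_val, if_pos (by omega)]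
    rfl
  have hfront' : SimplexCategory.δ (Fin.last (m + 1)) ≫
      SimplexCategory.subinterval (n := m + 1 + 1) 0 (m + 1) (by omega) =
        SimplexCategory.subinterval (n := m + 1 + 1) 0 m (by omega) := by
    refine simplexCategory_hom_ext fun k => ?_
    have hk := k.2
    rw [δ_comp_subinterval_val, Fin.val_last, if_pos (by omega)]
    rfl
  have htri (i : Fin 3) (j : Fin (m + 3)) (hj : (j : ℕ) = i + m) (hi : (i : ℕ) ≠ 0) :
      SimplexCategory.subinterval m 1 le_rfl ≫ SimplexCategory.δ j =
        SimplexCategory.δ i ≫ SimplexCategory.subinterval (n := m + 1 + 1) m 2 (by omega) := by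
    refine simplexCategory_hom_ext fun k => ?_
    rw [subinterval_comp_δ_val, δ_comp_subinterval_val]
    split_ifs <;> omega
  have htri0 : SimplexCategory.subinterval (n := m + 1 + 1) (m + 1) 1 le_rfl =
      SimplexCategory.δ (0 : Fin 3) ≫
        SimplexCategory.subinterval (n := m + 1 + 1) m 2 (by omega) := by
    refine simplexCategory_hom_ext fun k => ?_
    rw [δ_comp_subinterval_val, Fin.val_zero, if_neg (by omega)]
    exact (by omega : (k : ℕ) + (m + 1) = k + 1 + m)
  -- The last two faces of σ share the front face [0, …, m]. The cocycle rule on the triangle [m, m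
  -- + 1, m + 2] merges their terms into the last term of `cup (d b) z`.
  have hz' := mem_cocycles_one_iff.1 hz
    (S.map (SimplexCategory.subinterval (n := m + 1 + 1) m 2 (by omega)).op σ)
  rw [hface', hface', hface', ← htri 1 (Fin.last (m + 1)).castSucc (by simp [add_comm]) (by simp),
    ← htri 2 (Fin.last (m + 2)) (by simp [add_comm]) (by simp), ← htri0] at hz'
  rw [Fin.sum_univ_castSucc, hfront'] at hR
  rw [hL, hR, Fin.sum_univ_castSucc, Fin.sum_univ_castSucc, hfront (Fin.last (m + 1)).castSucc
    (by simp), hfront (Fin.last (m + 2)) (by simp), hz']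
  simp only [hlow, hedge, Fin.val_castSucc, Fin.val_last, add_mul, Finset.sum_mul, mul_assoc]
  ring

/-- For odd `p`, the proper cup powers of a `1`-cocycle are coboundaries. -/
lemma cupPow_mem_coboundaries {p : ℕ} [Fact p.Prime] (hp : 2 < p) {z : Cochain S (ZMod p) 1}
    (hz : z ∈ cocycles S (ZMod p) 1) (k : ℕ) :
    cupPow z (k + 2) ∈ coboundaries S (ZMod p) (k + 2) := by
  induction k with
  | zero =>
    have h2 : (2 : ZMod p) ≠ 0 := by
      intro h
      have h' : ((2 : ℕ) : ZMod p) = 0 := by exact_mod_cast h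
      rw [ZMod.natCast_eq_zero_iff] at h'
      exact absurd (Nat.le_of_dvd two_pos h') hp.not_ge
    -- With u and v the values on the first and last edges, ((u + v) ^ 2 - u ^ 2 - v ^ 2) / 2 = u v.
    refine ⟨fun τ => -z τ ^ 2 / 2, ?_⟩
    funext σ
    change _ = cup z z σ
    rw [d_one_apply, mem_cocycles_one_iff.1 hz, cup_one_one_apply]
    field_simp
    ring
  | succ k ih =>
    obtain ⟨b, hb⟩ := ih
    exact ⟨cup (m := k + 1) b z, (d_cup_cocycle b hz).trans
      (congrArg (fun c => cup (m := k + 2) c z) hb)⟩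

end CupPowers

end MasseyPower

end

/-! ### The main theorem -/

theorem mainTheorem10 (p : ℕ) [Fact p.Prime] (X : Type*) [TopologicalSpace X]
    [PathConnectedSpace X] (x : X)
    (e : FundamentalGroup X x ≃* Multiplicative (ZMod p)) :
    -- `H¹(X; 𝔽_p) = 𝔽_p · T`, where `T` evaluates on loops as the isomorphism `π₁ ≅ C_p`
    (∃ T : MasseyPower.H (MasseyPower.Sing X) (ZMod p) 1,
      Submodule.span (ZMod p) {T} = ⊤ ∧
      ∀ a, MasseyPower.cls a = T → ∀ γ : Path x x,
        a.1 (MasseyPower.pathSimplex γ) =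
          (e (FundamentalGroup.fromPath (Path.Homotopic.Quotient.mk γ))).toAdd) ∧
    -- every generator has the stated cup and Massey powers
    ∀ T : MasseyPower.H (MasseyPower.Sing X) (ZMod p) 1,
      Submodule.span (ZMod p) {T} = ⊤ →
      (∀ k : ℕ, 2 ≤ k → k < p →
        (∀ a, MasseyPower.cls a = T →
          MasseyPower.cupPow a.1 k ∈ MasseyPower.coboundaries (MasseyPower.Sing X) (ZMod p) k) ∧
        MasseyPower.masseyPower T k = {0}) ∧
      ∃ μ : MasseyPower.H (MasseyPower.Sing X) (ZMod p) 2,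
        μ ≠ 0 ∧ MasseyPower.masseyPower T p = {μ} := by
  have hp := (Fact.out : p.Prime)
  obtain ⟨g, hg⟩ := MasseyPower.exists_loopClass_eq e 1
  refine ⟨⟨MasseyPower.fundamentalClass e, MasseyPower.span_fundamentalClass e,
    fun a ha γ => MasseyPower.fundamentalClass_loop e ha γ⟩, fun T hT => ?_⟩
  obtain ⟨z, rfl⟩ := MasseyPower.cls_surjective T
  have hz := MasseyPower.loop_ne_zero_of_span_eq_top e hT hg
  refine ⟨fun k hk hkp => ⟨fun a _ => ?_, ?_⟩, ?_⟩
  · obtain ⟨k, rfl⟩ := Nat.exists_eq_add_of_le' hk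
    exact MasseyPower.cupPow_mem_coboundaries (by omega) a.2 k
  · refine Set.eq_singleton_iff_nonempty_unique_mem.2
      ⟨⟨_, MasseyPower.binomialSystem z hkp.le, rfl⟩, ?_⟩
    rintro _ ⟨D, rfl⟩
    obtain ⟨r, hr⟩ := D.valueCochain_eq e (by omega) hkp.le hg
    rw [if_neg hkp.ne, zero_smul, add_zero] at hr
    exact MasseyPower.cls_eq_zero_iff.2 ⟨r, hr.symm⟩
  · refine ⟨(MasseyPower.binomialSystem z le_rfl).value,
      (MasseyPower.binomialSystem z le_rfl).value_ne_zero e hz,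
      Set.eq_singleton_iff_unique_mem.2 ⟨⟨_, rfl⟩, ?_⟩⟩
    rintro _ ⟨D, rfl⟩
    obtain ⟨r, hr⟩ := D.valueCochain_eq e hp.ne_zero le_rfl hg
    obtain ⟨r', hr'⟩ := (MasseyPower.binomialSystem z le_rfl).valueCochain_eq e hp.ne_zero le_rfl hg
    -- Both values have the same multiple of the carry cochain, so it cancels in the difference.
    refine MasseyPower.cls_eq_cls_iff.2 ⟨r - r', ?_⟩
    rw [map_sub]
    change _ = D.valueCochain - (MasseyPower.binomialSystem z le_rfl).valueCochain
    rw [hr, hr', add_sub_add_right_eq_sub]
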